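/- Let $\mathcal H$ be a complex Hilbert space, $H_0$ a self-adjoint operator in $\mathcal H$, and $B$ a Kato–Rellich perturbation of $H_0$; that is, $B$ is a symmetric operator with $D(H_0)\subseteq D(B)$ for which there are real numbers $a\ge 0$ and $b$ such that $\|B\phi\|\le a\|H_0\phi\|+b\|\phi\|$ for all $\phi\in D(H_0)$, and the infimum of all such $a$ is smaller than $1$. Put $H=H_0+B$ with $D(H)=D(H_0)$. For an operator $T$, let the powers $T^n$ have their natural domains ($T^0=I$, $D(T^{n+1})=\{\phi\in D(T^n): T^n\phi\in D(T)\}$), and put $\mathcal D^\infty(T)=\bigcap_{n\ge 1}D(T^n)$. Assume that $B$ maps $\mathcal D^\infty(H_0)$ into itself. Then $$\mathcal D^\infty(H_0)\subseteq \mathcal D^\infty(H).$$ Moreover, suppose that the family of seminorms $\phi\mapsto\|H_0^n\phi\|$, $n=0,1,2,\dots$, on $\mathcal D^\infty(H_0)$ is directed, i.e. for all $m,n\ge 0$ there are $p\ge 0$ and $C\ge 0$ with $\max\{\|H_0^m\phi\|,\|H_0^n\phi\|\}\le C\|H_0^p\phi\|$ for all $\phi\in\mathcal D^\infty(H_0)$.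 Then for all integers $k,s\ge 0$ there are an integer $\ell\ge 0$ and a constant $C>0$ such that, for every $\phi\in\mathcal D^\infty(H_0)$, the vector $H_0^sH^k\phi$ is defined and $$\|H_0^sH^k\phi\|\le C\,\|H_0^\ell\phi\|.$$ -/

import Mathlib

open scoped NNReal

namespace UnboundedOp

variable {E : Type*} [NormedAddCommGroup E] [InnerProductSpace ℂ E]

/-- The product `S T` of two unbounded operators on its natural (maximal) domain
`D(S T) = {x ∈ D(T) | T x ∈ D(S)}`. -/
def prod (S T : E →ₗ.[ℂ] E) : E →ₗ.[ℂ] E where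
  domain :=
    { carrier := {x | ∃ h : x ∈ T.domain, T ⟨x, h⟩ ∈ S.domain}
      add_mem' := by
        rintro x y ⟨hx, hx'⟩ ⟨hy, hy'⟩
        refine ⟨T.domain.add_mem hx hy, ?_⟩
        have h := T.map_add ⟨x, hx⟩ ⟨y, hy⟩
        rw [AddMemClass.mk_add_mk] at h
        rw [h]
        exact S.domain.add_mem hx' hy'
      zero_mem' := by
        refine ⟨T.domain.zero_mem, ?_⟩
        have h : T ⟨0, T.domain.zero_mem⟩ = 0 := T.map_zero
        rw [h]
        exact S.domain.zero_mem
      smul_mem' := by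
        rintro c x ⟨hx, hx'⟩
        refine ⟨T.domain.smul_mem c hx, ?_⟩
        have h := T.map_smul c ⟨x, hx⟩
        rw [SetLike.mk_smul_mk] at h
        rw [h]
        exact S.domain.smul_mem c hx' }
  toFun :=
    { toFun := fun x => S ⟨T ⟨x.1, x.2.1⟩, x.2.2⟩
      map_add' := by
        intro x y
        rw [← S.map_add]
        congr 1
        exact Subtype.ext (T.map_add ⟨x.1, x.2.1⟩ ⟨y.1, y.2.1⟩)
      map_smul' := by
        intro c x
        rw [RingHom.id_apply, ← S.map_smul]
        congr 1
        exact Subtype.ext (T.map_smul c ⟨x.1, x.2.1⟩) }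

/-- The powers `T ^ n` of an unbounded operator, on their natural domains: `T ^ 0` is the identity
on the whole space and `D(T ^ (n + 1)) = {x ∈ D(T ^ n) | T ^ n x ∈ D(T)}`. -/
def pow (T : E →ₗ.[ℂ] E) : ℕ → (E →ₗ.[ℂ] E)
  | 0 => (LinearMap.id : E →ₗ[ℂ] E).toPMap ⊤
  | n + 1 => prod T (pow T n)

/-- The space `D^∞(T) = ⋂ₙ D(T ^ n)` of `C^∞`-vectors of `T`. -/
def smoothDomain (T : E →ₗ.[ℂ] E) : Submodule ℂ E :=
  ⨅ n : ℕ, (pow T n).domain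

/-- The linear map `φ ↦ T ^ n φ` on `D^∞(T)`. -/
def powSmooth (T : E →ₗ.[ℂ] E) (n : ℕ) : smoothDomain T →ₗ[ℂ] E :=
  (pow T n).toFun.comp (Submodule.inclusion (iInf_le (fun m : ℕ => (pow T m).domain) n))

/-- The seminorms `φ ↦ ‖T ^ n φ‖`, `n = 0, 1, …`, defining the topology of `D^∞(T)`. -/
noncomputable def smoothSeminorm (T : E →ₗ.[ℂ] E) (n : ℕ) : Seminorm ℂ (smoothDomain T) :=
  (normSeminorm ℂ E).comp (powSmooth T n)

/-- A family of seminorms is directed if any two of its members are dominated, up to a constant,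
by a third member. -/
def IsDirectedFamily {V ι : Type*} [AddCommGroup V] [Module ℂ V] (p : ι → Seminorm ℂ V) : Prop :=
  ∀ i j, ∃ k, ∃ C : ℝ≥0, p i ⊔ p j ≤ C • p k

/-- The operator `B` maps the subspace `M` into itself: `M ⊆ D(B)` and `B M ⊆ M`. -/
def MapsInto (B : E →ₗ.[ℂ] E) (M : Submodule ℂ E) : Prop :=
  ∀ x ∈ M, ∃ h : x ∈ B.domain, B ⟨x, h⟩ ∈ M

/-- The numbers `a ≥ 0` for which there is a real `b` with `‖B φ‖ ≤ a ‖H₀ φ‖ + b ‖φ‖` for all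
`φ ∈ D(H₀)`, where `D(H₀) ⊆ D(B)`. -/
def relBounds (H₀ B : E →ₗ.[ℂ] E) (h : H₀.domain ≤ B.domain) : Set ℝ :=
  {a | 0 ≤ a ∧ ∃ b : ℝ, ∀ φ : H₀.domain,
    ‖B (Submodule.inclusion h φ)‖ ≤ a * ‖H₀ φ‖ + b * ‖(φ : E)‖}

/-- `B` is a Kato–Rellich perturbation of `H₀`: it is symmetric, `D(H₀) ⊆ D(B)`, and it is
`H₀`-bounded with relative bound smaller than `1`. -/
structure IsKatoRellich (H₀ B : E →ₗ.[ℂ] E) : Prop where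
  symmetric : B.IsFormalAdjoint B
  domain_le : H₀.domain ≤ B.domain
  bounded : (relBounds H₀ B domain_le).Nonempty
  relBound_lt_one : sInf (relBounds H₀ B domain_le) < 1

end UnboundedOp

namespace UnboundedOp

/-! ### Powers and products of unbounded operators, read through graphs -/

section Products

variable {E : Type*} [NormedAddCommGroup E] [InnerProductSpace ℂ E]

/-! `H₀` and `B` preserve `D^∞(H₀)`, hence so does their sum `S`, whose iterates there are the
powers of `H`; this gives the inclusion. For the estimate, the point is that `B` is automatically
continuous on `D^∞(H₀)`, a Fréchet space because `H₀` is closed, hence barrelled. The relative bound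
controls `‖B φ‖`. Inductively, self-adjointness makes `‖H₀^(m+1) B φ‖` a supremum of the functions
`|⟨H₀^m B φ, H₀ z⟩|`, which are continuous in `φ`; it is thus a lower semicontinuous seminorm, and
barrelledness makes it continuous (`continuous_powSmooth_comp`). Directedness reduces the resulting
finite suprema to one seminorm, and such bounds are stable under sums and composition. -/

lemma mem_graph_prod_iff {S T : E →ₗ.[ℂ] E} {x z : E} :
    (x, z) ∈ (prod S T).graph ↔ ∃ y, (x, y) ∈ T.graph ∧ (y, z) ∈ S.graph := by
  simp only [LinearPMap.mem_graph_iff]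
  constructor
  · rintro ⟨w, rfl, hz⟩
    exact ⟨T ⟨w.1, w.2.1⟩, ⟨⟨w.1, w.2.1⟩, rfl, rfl⟩, ⟨⟨_, w.2.2⟩, rfl, hz⟩⟩
  · rintro ⟨y, ⟨⟨w, hw⟩, rfl, rfl⟩, ⟨⟨v, hv⟩, rfl, rfl⟩⟩
    exact ⟨⟨w, hw, hv⟩, rfl, rfl⟩

lemma mem_graph_pow_zero (T : E →ₗ.[ℂ] E) (x : E) : (x, x) ∈ (pow T 0).graph :=
  (LinearPMap.mem_graph_iff _).2 ⟨⟨x, trivial⟩, rfl, rfl⟩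

lemma mem_graph_pow_succ {T : E →ₗ.[ℂ] E} {n : ℕ} {x y z : E} (hxy : (x, y) ∈ (pow T n).graph)
    (hyz : (y, z) ∈ T.graph) : (x, z) ∈ (pow T (n + 1)).graph :=
  mem_graph_prod_iff.2 ⟨y, hxy, hyz⟩

lemma mem_graph_powSmooth (T : E →ₗ.[ℂ] E) (n : ℕ) (x : smoothDomain T) :
    ((x : E), powSmooth T n x) ∈ (pow T n).graph :=
  (LinearPMap.mem_graph_iff _).2 ⟨_, rfl, rfl⟩

lemma powSmooth_eq {T : E →ₗ.[ℂ] E} {n : ℕ} {x : smoothDomain T} {y : E}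
    (h : ((x : E), y) ∈ (pow T n).graph) : powSmooth T n x = y :=
  LinearPMap.mem_graph_snd_inj _ (mem_graph_powSmooth T n x) h rfl

lemma powSmooth_zero (T : E →ₗ.[ℂ] E) (x : smoothDomain T) : powSmooth T 0 x = x :=
  powSmooth_eq (mem_graph_pow_zero T x)

lemma powSmooth_succ_mem_graph (T : E →ₗ.[ℂ] E) (n : ℕ) (x : smoothDomain T) :
    (powSmooth T n x, powSmooth T (n + 1) x) ∈ T.graph := by
  obtain ⟨y, hxy, hy⟩ := mem_graph_prod_iff.1 (mem_graph_powSmooth T (n + 1) x)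
  rwa [powSmooth_eq hxy]

lemma mem_graph_pow_of_seq {T : E →ₗ.[ℂ] E} {u : ℕ → E}
    (hu : ∀ n, (u n, u (n + 1)) ∈ T.graph) (n : ℕ) : (u 0, u n) ∈ (pow T n).graph := by
  induction n with
  | zero => exact mem_graph_pow_zero T _
  | succ n ih => exact mem_graph_pow_succ ih (hu n)

lemma mem_smoothDomain_of_seq {T : E →ₗ.[ℂ] E} {u : ℕ → E}
    (hu : ∀ n, (u n, u (n + 1)) ∈ T.graph) : u 0 ∈ smoothDomain T :=
  (Submodule.mem_iInf _).2 fun n => LinearPMap.mem_domain_of_mem_graph (mem_graph_pow_of_seq hu n)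

/-- The iterates of `S` form an orbit of `T`, so every power of `T` is defined on `M` and agrees
there with that of `S`. -/
lemma mem_graph_pow_of_invariant {T : E →ₗ.[ℂ] E} {M : Submodule ℂ E} {S : M →ₗ[ℂ] M}
    (hS : ∀ x : M, ((x : E), (S x : E)) ∈ T.graph) (n : ℕ) (x : M) :
    ((x : E), ((S ^ n) x : E)) ∈ (pow T n).graph := by
  refine mem_graph_pow_of_seq (u := fun n => ((S ^ n) x : E)) (fun n => ?_) n
  rw [pow_succ']
  exact hS _

/-- The restriction of `T` to the space of its smooth vectors. -/
def restrictSmooth (T : E →ₗ.[ℂ] E) : smoothDomain T →ₗ[ℂ] smoothDomain T :=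
  (powSmooth T 1).codRestrict _ fun x =>
    mem_smoothDomain_of_seq (u := fun n => powSmooth T (n + 1) x)
      fun n => powSmooth_succ_mem_graph T (n + 1) x

lemma mem_graph_restrictSmooth (T : E →ₗ.[ℂ] E) (x : smoothDomain T) :
    ((x : E), (restrictSmooth T x : E)) ∈ T.graph := by
  have h := powSmooth_succ_mem_graph T 0 x
  rwa [powSmooth_zero] at h

lemma powSmooth_restrictSmooth (T : E →ₗ.[ℂ] E) (n : ℕ) (x : smoothDomain T) :
    powSmooth T n (restrictSmooth T x) = powSmooth T (n + 1) x :=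
  powSmooth_eq (mem_graph_pow_of_seq (u := fun n => powSmooth T (n + 1) x)
    (fun n => powSmooth_succ_mem_graph T (n + 1) x) n)

/-- The restriction of `B` to a subspace that it maps into itself. -/
def MapsInto.restrict {B : E →ₗ.[ℂ] E} {M : Submodule ℂ E} (h : MapsInto B M) : M →ₗ[ℂ] M :=
  (B.toFun.comp (Submodule.inclusion fun x hx => (h x hx).1)).codRestrict M fun x => (h x x.2).2

lemma MapsInto.mem_graph_restrict {B : E →ₗ.[ℂ] E} {M : Submodule ℂ E} (h : MapsInto B M)
    (x : M) : ((x : E), (h.restrict x : E)) ∈ B.graph :=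
  (LinearPMap.mem_graph_iff _).2 ⟨_, rfl, rfl⟩

lemma add_mem_graph {S T : E →ₗ.[ℂ] E} {x y z : E} (hy : (x, y) ∈ S.graph)
    (hz : (x, z) ∈ T.graph) : (x, y + z) ∈ (S + T).graph := by
  rw [LinearPMap.mem_graph_iff] at hy hz ⊢
  obtain ⟨⟨w, hw⟩, rfl, rfl⟩ := hy
  obtain ⟨⟨v, hv⟩, rfl, rfl⟩ := hz
  exact ⟨⟨_, hw, hv⟩, rfl, rfl⟩

end Products

/-! ### The Fréchet topology of smooth vectors -/

section Orbits

variable {E : Type*} [NormedAddCommGroup E] [InnerProductSpace ℂ E]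

/-- The space of sequences `(x, T x, T² x, …)`, a model of `D^∞(T)` that inherits its topology
from the product topology of `ℕ → E`. -/
def orbitSpace (T : E →ₗ.[ℂ] E) : Submodule ℂ (ℕ → E) :=
  ⨅ n, T.graph.comap ((LinearMap.proj n).prod (LinearMap.proj (n + 1)))

lemma mem_orbitSpace {T : E →ₗ.[ℂ] E} {u : ℕ → E} :
    u ∈ orbitSpace T ↔ ∀ n, (u n, u (n + 1)) ∈ T.graph := by
  simp only [orbitSpace, Submodule.mem_iInf]
  rfl

lemma isClosed_orbitSpace {T : E →ₗ.[ℂ] E} (hT : T.IsClosed) :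
    IsClosed (orbitSpace T : Set (ℕ → E)) := by
  have h : (orbitSpace T : Set (ℕ → E)) = ⋂ n, (fun u => (u n, u (n + 1))) ⁻¹' T.graph := by
    ext u
    simp [mem_orbitSpace]
  rw [h]
  exact isClosed_iInter fun n => IsClosed.preimage (by fun_prop) hT

/-- A closed subspace of a countable product of Hilbert spaces is completely metrizable, hence
Baire, hence barrelled. -/
lemma barrelledSpace_orbitSpace [CompleteSpace E] {T : E →ₗ.[ℂ] E} (hT : T.IsClosed) :
    BarrelledSpace ℂ (orbitSpace T) := by
  have : CompleteSpace (orbitSpace T) := (isClosed_orbitSpace hT).completeSpace_coe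
  have : (uniformity (orbitSpace T)).IsCountablyGenerated := by
    rw [uniformity_subtype]
    infer_instance
  have : BaireSpace (orbitSpace T) := inferInstance
  exact BaireSpace.instBarrelledSpace

/-- The initial vector of an orbit, as a smooth vector. -/
def orbitStart (T : E →ₗ.[ℂ] E) : orbitSpace T →ₗ[ℂ] smoothDomain T :=
  ((LinearMap.proj 0).comp (orbitSpace T).subtype).codRestrict _ fun u =>
    mem_smoothDomain_of_seq (mem_orbitSpace.1 u.2)

lemma powSmooth_orbitStart (T : E →ₗ.[ℂ] E) (n : ℕ) (u : orbitSpace T) :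
    powSmooth T n (orbitStart T u) = u.1 n :=
  powSmooth_eq (mem_graph_pow_of_seq (mem_orbitSpace.1 u.2) n)

lemma orbitStart_surjective (T : E →ₗ.[ℂ] E) : Function.Surjective (orbitStart T) := fun x =>
  ⟨⟨fun n => powSmooth T n x, mem_orbitSpace.2 fun n => powSmooth_succ_mem_graph T n x⟩,
    Subtype.ext (powSmooth_zero T x)⟩

lemma withSeminorms_orbitSpace (T : E →ₗ.[ℂ] E) :
    WithSeminorms fun n => (smoothSeminorm T n).comp (orbitStart T) := by
  -- The product family is indexed by pairs in `Σ _ : ℕ, Fin 1`; the equivalence drops the trivial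
  -- second index.
  have h : WithSeminorms (fun n : ℕ => (normSeminorm ℂ E).comp (LinearMap.proj n)) := by
    exact (withSeminorms_pi (𝕜 := ℂ) (E := fun _ : ℕ => E)
      fun _ => norm_withSeminorms ℂ E).congr_equiv (Equiv.sigmaUnique ℕ fun _ => Fin 1).symm
  convert! LinearMap.withSeminorms_induced h (orbitSpace T).subtype using 1
  ext n u
  exact congrArg norm (powSmooth_orbitStart T n u)

/-- A seminorm on `D^∞(T)` that is continuous on orbits is dominated by finitely many of the
defining seminorms. -/
lemma exists_le_finset_sup_of_continuous {T : E →ₗ.[ℂ] E} (p : Seminorm ℂ (smoothDomain T))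
    (hp : Continuous (p.comp (orbitStart T))) :
    ∃ (s : Finset ℕ) (C : ℝ≥0), p ≤ C • s.sup (smoothSeminorm T) := by
  obtain ⟨s, C, -, h⟩ := Seminorm.bound_of_continuous (withSeminorms_orbitSpace T) _ hp
  refine ⟨s, C, fun x => ?_⟩
  obtain ⟨u, rfl⟩ := orbitStart_surjective T x
  refine (h u).trans_eq ?_
  rw [smul_apply, smul_apply]
  congr 1
  exact (DFunLike.congr_fun
    (SeminormFamily.finset_sup_comp (smoothSeminorm T) s (orbitStart T)) u).symm

end Orbits

/-! ### Automatic continuity from barrelledness -/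

section Automatic

variable {E : Type*} [NormedAddCommGroup E] [InnerProductSpace ℂ E]

/-- For a self-adjoint `T`, `‖T x‖ ≤ r` can be tested weakly against `T` on its domain. -/
lemma norm_le_iff_of_mem_graph [CompleteSpace E] {T : E →ₗ.[ℂ] E} (hT : IsSelfAdjoint T)
    {x y : E} (h : (x, y) ∈ T.graph) {r : ℝ} (hr : 0 ≤ r) :
    ‖y‖ ≤ r ↔ ∀ z : T.domain, ‖inner ℂ x (T z)‖ ≤ r * ‖(z : E)‖ := by
  have hsymm : T.IsFormalAdjoint T := by
    have := LinearPMap.adjoint_isFormalAdjoint hT.dense_domain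
    rwa [LinearPMap.isSelfAdjoint_def.1 hT] at this
  obtain ⟨w, rfl, rfl⟩ := (LinearPMap.mem_graph_iff _).1 h
  have hin : ∀ z : T.domain, inner ℂ (w : E) (T z) = inner ℂ (T w) (z : E) :=
    fun z => (hsymm w z).symm
  simp only [hin]
  constructor
  · exact fun hle z => (norm_inner_le_norm _ _).trans (by gcongr)
  · intro hz
    -- The weak bound extends from the dense domain to all of `E` by continuity.
    have hall : ∀ z : E, ‖inner ℂ (T w) z‖ ≤ r * ‖z‖ := fun z =>
      hT.dense_domain.induction (P := fun z => ‖inner ℂ (T w) z‖ ≤ r * ‖z‖)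
        (fun z hz' => hz ⟨z, hz'⟩)
        (isClosed_le (by fun_prop) (by fun_prop)) z
    rw [← innerSL_apply_norm ℂ (T w)]
    exact ContinuousLinearMap.opNorm_le_bound _ hr hall

/-- A linear map of `D^∞(T)` into itself that is continuous for the norm of the target is
continuous for the topology of `D^∞(T)`, by the barrelledness of this space. -/
lemma continuous_powSmooth_comp [CompleteSpace E] {T : E →ₗ.[ℂ] E} (hT : IsSelfAdjoint T)
    (S : smoothDomain T →ₗ[ℂ] smoothDomain T)
    (hS : Continuous fun u : orbitSpace T => (S (orbitStart T u) : E)) (m : ℕ) :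
    Continuous fun u : orbitSpace T => powSmooth T m (S (orbitStart T u)) := by
  induction m with
  | zero => simpa only [powSmooth_zero] using hS
  | succ m ih =>
    have := barrelledSpace_orbitSpace hT.isClosed
    let L : orbitSpace T →ₗ[ℂ] E := powSmooth T (m + 1) ∘ₗ S ∘ₗ orbitStart T
    have hlsc : LowerSemicontinuous ((normSeminorm ℂ E).comp L) := by
      rw [lowerSemicontinuous_iff_isClosed_preimage]
      intro r
      rcases lt_or_ge r 0 with hr | hr
      · convert! isClosed_empty using 1
        ext u
        simpa using hr.trans_le (norm_nonneg (L u))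
      -- Testing weakly moves one factor `T` onto `z`, so only the power `m`, continuous by `ih`,
      -- remains.
      · have hset : (normSeminorm ℂ E).comp L ⁻¹' Set.Iic r = ⋂ z : T.domain,
            {u | ‖inner ℂ (powSmooth T m (S (orbitStart T u))) (T z)‖ ≤ r * ‖(z : E)‖} := by
          ext u
          rw [Set.mem_iInter]
          exact norm_le_iff_of_mem_graph hT
            (powSmooth_succ_mem_graph T m (S (orbitStart T u))) hr
        rw [hset]
        exact isClosed_iInter fun z => isClosed_le (by fun_prop) (by fun_prop)
    have hcont := Seminorm.continuous_of_lowerSemicontinuous _ hlsc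
    refine continuous_of_continuousAt_zero L ?_
    rw [ContinuousAt, map_zero, tendsto_zero_iff_norm_tendsto_zero]
    have h0 := hcont.tendsto 0
    rwa [map_zero] at h0

end Automatic

/-! ### Single-seminorm bounds -/

section Bounded

variable {E : Type*} [NormedAddCommGroup E] [InnerProductSpace ℂ E]

/-- Each seminorm of `S x` is dominated by a single seminorm of `x`. -/
def IsSmoothBounded (T : E →ₗ.[ℂ] E) (S : smoothDomain T →ₗ[ℂ] smoothDomain T) : Prop :=
  ∀ m, ∃ (l : ℕ) (C : ℝ≥0), ∀ x, ‖powSmooth T m (S x)‖ ≤ C * ‖powSmooth T l x‖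

lemma isSmoothBounded_restrictSmooth (T : E →ₗ.[ℂ] E) : IsSmoothBounded T (restrictSmooth T) :=
  fun m => ⟨m + 1, 1, fun x => by simp [powSmooth_restrictSmooth]⟩

lemma IsSmoothBounded.comp {T : E →ₗ.[ℂ] E} {R S : smoothDomain T →ₗ[ℂ] smoothDomain T}
    (hR : IsSmoothBounded T R) (hS : IsSmoothBounded T S) : IsSmoothBounded T (R * S) := by
  intro m
  obtain ⟨l, C, h⟩ := hR m
  obtain ⟨l', C', h'⟩ := hS l
  refine ⟨l', C * C', fun x => (h (S x)).trans ?_⟩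
  rw [NNReal.coe_mul, mul_assoc]
  gcongr
  exact h' x

lemma IsSmoothBounded.pow {T : E →ₗ.[ℂ] E} {S : smoothDomain T →ₗ[ℂ] smoothDomain T}
    (hS : IsSmoothBounded T S) (k : ℕ) : IsSmoothBounded T (S ^ k) := by
  induction k with
  | zero => exact fun m => ⟨m, 1, fun x => by simp⟩
  | succ k ih => exact pow_succ S k ▸ ih.comp hS

/-- The two summands may need different seminorms; directedness supplies a common one. -/
lemma IsSmoothBounded.add {T : E →ₗ.[ℂ] E} (hdir : IsDirectedFamily (smoothSeminorm T))
    {R S : smoothDomain T →ₗ[ℂ] smoothDomain T}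
    (hR : IsSmoothBounded T R) (hS : IsSmoothBounded T S) : IsSmoothBounded T (R + S) := by
  intro m
  obtain ⟨i, C, h⟩ := hR m
  obtain ⟨j, C', h'⟩ := hS m
  obtain ⟨k, D, hD⟩ := hdir i j
  refine ⟨k, C * D + C' * D, fun x => ?_⟩
  have hi : ‖powSmooth T i x‖ ≤ D * ‖powSmooth T k x‖ := (le_sup_left.trans hD) x
  have hj : ‖powSmooth T j x‖ ≤ D * ‖powSmooth T k x‖ := (le_sup_right.trans hD) x
  calc ‖powSmooth T m ((R + S) x)‖
      ≤ ‖powSmooth T m (R x)‖ + ‖powSmooth T m (S x)‖ := by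
        rw [LinearMap.add_apply, map_add]
        exact norm_add_le _ _
    _ ≤ C * (D * ‖powSmooth T k x‖) + C' * (D * ‖powSmooth T k x‖) :=
        add_le_add ((h x).trans (by gcongr)) ((h' x).trans (by gcongr))
    _ = ↑(C * D + C' * D) * ‖powSmooth T k x‖ := by push_cast; ring

lemma IsDirectedFamily.exists_finset_sup_le {V ι : Type*} [AddCommGroup V] [Module ℂ V]
    [Nonempty ι] {p : ι → Seminorm ℂ V} (hp : IsDirectedFamily p) (s : Finset ι) :
    ∃ (k : ι) (C : ℝ≥0), s.sup p ≤ C • p k := by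
  classical
  induction s using Finset.induction_on with
  | empty => exact ⟨Classical.arbitrary ι, 0, by simp⟩
  | insert i s _ ih =>
    obtain ⟨j, C, h⟩ := ih
    obtain ⟨k, D, hD⟩ := hp i j
    refine ⟨k, D + C * D, ?_⟩
    rw [Finset.sup_insert]
    refine sup_le (fun x => ?_) (fun x => (h x).trans ?_)
    · have hi : p i x ≤ D * p k x := (le_sup_left.trans hD) x
      refine hi.trans ?_
      change (D : ℝ) * p k x ≤ ((D + C * D : ℝ≥0) : ℝ) * p k x
      gcongr
      exact le_self_add
    · have hj : p j x ≤ D * p k x := (le_sup_right.trans hD) x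
      change (C : ℝ) * p j x ≤ ((D + C * D : ℝ≥0) : ℝ) * p k x
      calc (C : ℝ) * p j x ≤ C * (D * p k x) := by gcongr
        _ = ((C * D : ℝ≥0) : ℝ) * p k x := by push_cast; ring
        _ ≤ _ := by gcongr; exact le_add_self

lemma isSmoothBounded_of_continuous [CompleteSpace E] {T : E →ₗ.[ℂ] E} (hT : IsSelfAdjoint T)
    (hdir : IsDirectedFamily (smoothSeminorm T)) (S : smoothDomain T →ₗ[ℂ] smoothDomain T)
    (hS : Continuous fun u : orbitSpace T => (S (orbitStart T u) : E)) : IsSmoothBounded T S := by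
  intro m
  obtain ⟨s, C, h⟩ := exists_le_finset_sup_of_continuous ((smoothSeminorm T m).comp S)
    (continuous_powSmooth_comp hT S hS m).norm
  obtain ⟨k, D, hD⟩ := hdir.exists_finset_sup_le s
  refine ⟨k, C * D, fun x => (h x).trans ?_⟩
  rw [NNReal.coe_mul, mul_assoc]
  exact mul_le_mul_of_nonneg_left (hD x) C.2

/-- A Kato–Rellich perturbation is continuous from orbits to the underlying Hilbert space. -/
lemma IsKatoRellich.continuous_restrict {H₀ B : E →ₗ.[ℂ] E} (hB : IsKatoRellich H₀ B)
    (hinv : MapsInto B (smoothDomain H₀)) :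
    Continuous fun u : orbitSpace H₀ => (hinv.restrict (orbitStart H₀ u) : E) := by
  obtain ⟨a, -, b, hab⟩ := hB.bounded
  let L : orbitSpace H₀ →ₗ[ℂ] E :=
    (smoothDomain H₀).subtype ∘ₗ hinv.restrict ∘ₗ orbitStart H₀
  -- Only coordinates `0` and `1` of the orbit enter, and these are continuous.
  have hbound : ∀ u : orbitSpace H₀, ‖L u‖ ≤ a * ‖u.1 1‖ + b * ‖u.1 0‖ := by
    intro u
    obtain ⟨w, hw0, hw1⟩ := (LinearPMap.mem_graph_iff _).1 (mem_orbitSpace.1 u.2 0)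
    have hL : L u = B (Submodule.inclusion hB.domain_le w) :=
      LinearPMap.mem_graph_snd_inj B (hinv.mem_graph_restrict (orbitStart H₀ u))
        (LinearPMap.mem_graph B _) hw0.symm
    rw [hL]
    have h := hab w
    rwa [hw0, hw1] at h
  refine continuous_of_continuousAt_zero L ?_
  rw [ContinuousAt, map_zero, tendsto_zero_iff_norm_tendsto_zero]
  refine squeeze_zero (fun _ => norm_nonneg _) hbound ?_
  have hc : Continuous fun u : orbitSpace H₀ => a * ‖u.1 1‖ + b * ‖u.1 0‖ := by
    have hu (n : ℕ) : Continuous fun u : orbitSpace H₀ => u.1 n :=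
      (continuous_apply n).comp continuous_subtype_val
    exact ((hu 1).norm.const_mul a).add ((hu 0).norm.const_mul b)
  simpa using hc.tendsto 0

end Bounded

end UnboundedOp

theorem mainTheorem10 {E : Type*} [NormedAddCommGroup E] [InnerProductSpace ℂ E] [CompleteSpace E]
    (H₀ B : E →ₗ.[ℂ] E) (hH₀ : IsSelfAdjoint H₀)
    (hB : UnboundedOp.IsKatoRellich H₀ B)
    (hinv : UnboundedOp.MapsInto B (UnboundedOp.smoothDomain H₀)) :
    UnboundedOp.smoothDomain H₀ ≤ UnboundedOp.smoothDomain (H₀ + B) ∧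
    (UnboundedOp.IsDirectedFamily (UnboundedOp.smoothSeminorm H₀) →
      ∀ k s : ℕ, ∃ (l : ℕ) (C : ℝ), 0 < C ∧ ∀ φ : UnboundedOp.smoothDomain H₀,
        ∃ h : (φ : E) ∈
            (UnboundedOp.prod (UnboundedOp.pow H₀ s) (UnboundedOp.pow (H₀ + B) k)).domain,
          ‖UnboundedOp.prod (UnboundedOp.pow H₀ s) (UnboundedOp.pow (H₀ + B) k) ⟨φ, h⟩‖
            ≤ C * ‖UnboundedOp.powSmooth H₀ l φ‖) := by
  let S := UnboundedOp.restrictSmooth H₀ + hinv.restrict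
  have hS : ∀ x : UnboundedOp.smoothDomain H₀, ((x : E), (S x : E)) ∈ (H₀ + B).graph := fun x =>
    UnboundedOp.add_mem_graph (UnboundedOp.mem_graph_restrictSmooth H₀ x)
      (hinv.mem_graph_restrict x)
  have hpow := UnboundedOp.mem_graph_pow_of_invariant hS
  refine ⟨fun x hx => (Submodule.mem_iInf _).2 fun n =>
    LinearPMap.mem_domain_of_mem_graph (hpow n ⟨x, hx⟩), fun hdir k s => ?_⟩
  obtain ⟨l, C, hC⟩ := (((UnboundedOp.isSmoothBounded_restrictSmooth H₀).add hdir
    (UnboundedOp.isSmoothBounded_of_continuous hH₀ hdir _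
      (hB.continuous_restrict hinv))).pow k) s
  -- `C` may vanish; adding `1` makes the constant strictly positive.
  refine ⟨l, C + 1, by positivity, fun φ => ?_⟩
  obtain ⟨⟨w, hw⟩, rfl, hval⟩ := (LinearPMap.mem_graph_iff _).1
    (UnboundedOp.mem_graph_prod_iff.2
      ⟨_, hpow k φ, UnboundedOp.mem_graph_powSmooth H₀ s ((S ^ k) φ)⟩)
  refine ⟨hw, ?_⟩
  rw [hval]
  refine (hC φ).trans ?_
  gcongr
  linarith
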